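/- Let $D$ be an integral domain with quotient field $K$, and assume that $D$ is not a field. For a nonzero fractional ideal $I$ of $D$ put $I^{-1}=\{x\in K : xI\subseteq D\}$, $I_v=(I^{-1})^{-1}$, and $I_t=\bigcup\{J_v : J\subseteq I,\ J \text{ a nonzero finitely generated fractional ideal of } D\}$. A nonzero ideal $I$ of $D$ is a $t$-ideal if $I_t=I$; a maximal $t$-ideal is an ideal that is maximal among the proper $t$-ideals of $D$. A nonzero ideal $I$ of $D$ is invertible if $II^{-1}=D$, and $t$-invertible if $(II^{-1})_t=D$. $D$ is a Krull domain if there is a family of discrete (rank-one) valuation rings of $K$ whose intersection is $D$ and such that every nonzero element of $D$ is a nonunit in only finitely many of them; $D$ is locally factorial if $D_M$ is a UFD for every maximal ideal $M$ of $D$. Then: (1) $D$ is a PID if and only if every maximal ideal $M$ of $D$ is principal and satisfies $\bigcap_{n=1}^{\infty}M^n=(0)$. (2) $D$ is a Dedekind domain if and only if every maximal ideal $M$ of $D$ is invertible and satisfies $\bigcap_{n=1}^{\infty}M^n=(0)$. (3) $D$ is a UFD if and only if every maximal $t$-ideal $M$ of $D$ is principal and satisfies $\bigcap_{n=1}^{\infty}M^n=(0)$.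 (4) $D$ is a locally factorial Krull domain if and only if every maximal $t$-ideal $M$ of $D$ is invertible and satisfies $\bigcap_{n=1}^{\infty}M^n=(0)$. (5) $D$ is a Krull domain if and only if every maximal $t$-ideal $M$ of $D$ is $t$-invertible and satisfies $\bigcap_{n=1}^{\infty}(M^n)_v=(0)$. -/

import Mathlib

open scoped nonZeroDivisors

section

variable {D K : Type*} [CommRing D] [IsDomain D] [Field K] [Algebra D K] [IsFractionRing D K]

/-- The `v`-operation (divisorial closure) `I_v = (I⁻¹)⁻¹`, where `I⁻¹ = (D :_K I)`.
For the zero ideal, which is not in the domain of star operations, the value is `0`. -/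
noncomputable def vClosure (I : FractionalIdeal D⁰ K) : FractionalIdeal D⁰ K :=
  (I⁻¹)⁻¹

theorem vClosure_mono {I J : FractionalIdeal D⁰ K} (h : I ≤ J) : vClosure I ≤ vClosure J := by
  by_cases hI : I = 0
  · subst hI
    simp only [vClosure, FractionalIdeal.inv_zero']
    exact zero_le
  have hJ : J ≠ 0 := by
    rintro rfl
    exact hI (le_antisymm h zero_le)
  have inv_ne : ∀ L : FractionalIdeal D⁰ K, L ≠ 0 → L⁻¹ ≠ 0 := by
    intro L hL h0
    obtain ⟨a, ha, hmem⟩ := L.isFractional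
    have hin : algebraMap D K a ∈ L⁻¹ := by
      rw [FractionalIdeal.mem_inv_iff hL]
      intro y hy
      obtain ⟨z, hz⟩ := hmem y hy
      rw [FractionalIdeal.mem_one_iff]
      exact ⟨z, by rw [hz, Algebra.smul_def]⟩
    rw [h0, FractionalIdeal.mem_zero_iff] at hin
    exact nonZeroDivisors.ne_zero ha ((IsFractionRing.injective D K) (by simpa using hin))
  exact FractionalIdeal.inv_anti_mono (inv_ne J hJ) (inv_ne I hI)
    (FractionalIdeal.inv_anti_mono hI hJ h)

/-- The `t`-operation: `I_t` is the union of the `J_v` over all finitely generated fractional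
ideals `J ⊆ I`. (The zero ideal `J = 0` contributes only `0`, so for `I ≠ 0` this is the same
as the union over the nonzero finitely generated `J`.) -/
noncomputable def tClosure (I : FractionalIdeal D⁰ K) : FractionalIdeal D⁰ K :=
  ⟨{ carrier := {x | ∃ J : FractionalIdeal D⁰ K,
        (J : Submodule D K).FG ∧ J ≤ I ∧ x ∈ vClosure J}
     zero_mem' := ⟨0, by simpa using Submodule.fg_bot, zero_le, Submodule.zero_mem _⟩
     add_mem' := by
       rintro x y ⟨J, hJ, hJI, hx⟩ ⟨L, hL, hLI, hy⟩
       refine ⟨J ⊔ L, ?_, sup_le hJI hLI, ?_⟩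
       · rw [FractionalIdeal.coe_sup]
         exact hJ.sup hL
       · exact Submodule.add_mem _ (vClosure_mono le_sup_left hx) (vClosure_mono le_sup_right hy)
     smul_mem' := by
       rintro c x ⟨J, hJ, hJI, hx⟩
       exact ⟨J, hJ, hJI, Submodule.smul_mem _ c hx⟩ }, by
    obtain ⟨a, ha, h⟩ := (vClosure I).isFractional
    refine ⟨a, ha, ?_⟩
    rintro x ⟨J, -, hJI, hx⟩
    exact h x (vClosure_mono hJI hx)⟩

/-- `M` is a maximal `t`-ideal of `D`: it is maximal among the proper (nonzero) integral
`t`-ideals of `D`. -/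
def IsMaximalTIdeal (K : Type*) [Field K] [Algebra D K] [IsFractionRing D K]
    (M : Ideal D) : Prop :=
  Maximal (fun I : Ideal D => I ≠ ⊥ ∧ I ≠ ⊤ ∧
    tClosure (I : FractionalIdeal D⁰ K) = (I : FractionalIdeal D⁰ K)) M

/-- `I` is invertible: `I I⁻¹ = D`. -/
def IsInvertibleIdeal (K : Type*) [Field K] [Algebra D K] [IsFractionRing D K]
    (I : Ideal D) : Prop :=
  (I : FractionalIdeal D⁰ K) * (I : FractionalIdeal D⁰ K)⁻¹ = 1

/-- `I` is `t`-invertible: `(I I⁻¹)_t = D`. -/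
def IsTInvertibleIdeal (K : Type*) [Field K] [Algebra D K] [IsFractionRing D K]
    (I : Ideal D) : Prop :=
  tClosure ((I : FractionalIdeal D⁰ K) * (I : FractionalIdeal D⁰ K)⁻¹) = 1

end

/-- `D`, with quotient field `K`, is a Krull domain: it is a locally finite intersection of
discrete (rank-one) valuation rings of `K`, that is, `D = ⋂ V` over a family of discrete valuation
rings of `K` such that every nonzero element of `D` is a nonunit in only finitely many of them. -/
def IsKrullDomain (D K : Type*) [CommRing D] [IsDomain D] [Field K] [Algebra D K]
    [IsFractionRing D K] : Prop :=
  ∃ F : Set (ValuationSubring K),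
    (∀ V ∈ F, IsDiscreteValuationRing V) ∧
    (∀ x : K, x ∈ Set.range (algebraMap D K) ↔ ∀ V ∈ F, x ∈ V) ∧
    (∀ d : D, d ≠ 0 → {V ∈ F | algebraMap D K d ∈ V.nonunits}.Finite)

/-- `D` is locally factorial: `D_M` is a UFD for every maximal ideal `M`. -/
def IsLocallyFactorial (D : Type*) [CommRing D] [IsDomain D] : Prop :=
  ∀ (M : Ideal D) [M.IsMaximal], UniqueFactorizationMonoid (Localization.AtPrime M)

/-! The core is that the condition in (5) makes D_M a DVR at every maximal t-ideal M. Writing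
elements of J⁻¹ as b/c turns J_v into a divisibility condition inside D (`divClosure`), and M is
t-invertible exactly when M D_M = m D_M for some m ∈ M. Since M^n D_M ∩ D ⊆ (M^n)_v, separated
divisorial powers give every nonzero x a finite order n at M: s x = t m^n with s, t ∉ M. An ideal
lying in no maximal t-ideal contains a finitely generated J with J_v = D; this yields both D = ⋂ D_M
(`dvd_of_forall_isMaxT`) and finite character (`finite_isMaxT_mem`), so D is Krull.

Conversely, a Krull domain is completely integrally closed and each ideal has the v-closure of a
finitely generated subideal. Hence M⁻¹ contains some b/c ∉ D, and the powers of b/c have no common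
nonzero denominator, which forces both conditions on M (`isRegular_of_isKrullDomain`).

For (1) and (2), a prime P strictly inside an invertible maximal M satisfies P = PM, so P ⊆ ⋂ M^n =
0; Cohen-type theorems reduce the rest to primes. For (3) and (4), every nonzero prime contains a
maximal t-ideal (`exists_isMaxT_le_of_isPrime`), whose generator, in D or in D_N, is the prime
element required by Kaplansky's criterion. -/

namespace TIdeal

/-! ### The v- and t-operations on integral ideals -/

section Closure

variable {D : Type*} [CommRing D]

/-- The divisorial closure of an integral ideal, phrased by divisibility in the domain. -/
def divClosure (J : Ideal D) : Ideal D where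
  carrier := {x | ∀ b c : D, (∀ j ∈ J, c ∣ b * j) → c ∣ b * x}
  zero_mem' b c _ := by simp
  add_mem' hx hy b c h := by
    rw [mul_add]
    exact dvd_add (hx b c h) (hy b c h)
  smul_mem' r x hx b c h := by
    rw [smul_eq_mul, mul_left_comm]
    exact (hx b c h).mul_left r

theorem mem_divClosure {J : Ideal D} {x : D} :
    x ∈ divClosure J ↔ ∀ b c : D, (∀ j ∈ J, c ∣ b * j) → c ∣ b * x := Iff.rfl

theorem le_divClosure (J : Ideal D) : J ≤ divClosure J := fun x hx _ _ h => h x hx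

theorem divClosure_mono {I J : Ideal D} (h : I ≤ J) : divClosure I ≤ divClosure J :=
  fun _ hx b c hJ => hx b c fun j hj => hJ j (h hj)

theorem divClosure_le_of_le {I J : Ideal D} (h : I ≤ divClosure J) :
    divClosure I ≤ divClosure J :=
  fun _ hx b c hJ => hx b c fun _ hi => h hi b c hJ

/-- Testing b/c against xJ is testing bx/c against J, so 1 ∈ J_v puts x in (xJ)_v. -/
theorem mem_divClosure_of_mul_mem {J L : Ideal D} (hJ : 1 ∈ divClosure J) {x : D}
    (h : ∀ j ∈ J, x * j ∈ divClosure L) : x ∈ divClosure L := by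
  intro b c hL
  simpa using hJ (b * x) c fun j hj => by simpa [mul_assoc] using h j hj b c hL

theorem divClosure_span_singleton (x : D) : divClosure (Ideal.span {x}) = Ideal.span {x} := by
  refine le_antisymm (fun y hy => ?_) (le_divClosure _)
  rw [Ideal.mem_span_singleton]
  simpa using hy 1 x fun j hj => by simpa using Ideal.mem_span_singleton.1 hj

theorem divClosure_bot : divClosure (⊥ : Ideal D) = ⊥ := by
  simpa using divClosure_span_singleton (0 : D)

theorem one_mem_divClosure_mul {I J : Ideal D} (hI : 1 ∈ divClosure I) (hJ : 1 ∈ divClosure J) :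
    1 ∈ divClosure (I * J) := by
  refine mem_divClosure_of_mul_mem hI fun i hi => mem_divClosure_of_mul_mem hJ fun j hj => ?_
  rw [one_mul]
  exact le_divClosure _ (Ideal.mul_mem_mul hi hj)

theorem one_mem_divClosure_pow {J : Ideal D} (hJ : 1 ∈ divClosure J) (n : ℕ) :
    1 ∈ divClosure (J ^ n) := by
  induction n with
  | zero => exact le_divClosure _ (by simp)
  | succ n ih => rw [pow_succ]; exact one_mem_divClosure_mul ih hJ

theorem sup_pow_le_pow_sup (I J : Ideal D) (n : ℕ) : (I ⊔ J) ^ n ≤ I ^ n ⊔ J := by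
  induction n with
  | zero => simp
  | succ n ih =>
    rw [pow_succ, pow_succ]
    refine (Ideal.mul_mono_left ih).trans ?_
    rw [Ideal.mul_sup, Ideal.sup_mul, Ideal.sup_mul]
    refine sup_le (sup_le_sup_left Ideal.mul_le_left _) (le_sup_of_le_right ?_)
    exact sup_le Ideal.mul_le_right Ideal.mul_le_right

/-- The integral `t`-ideals, phrased by divisibility in the domain. -/
def IsTIdeal (I : Ideal D) : Prop := ∀ J : Ideal D, J.FG → J ≤ I → divClosure J ≤ I

/-- The maximal `t`-ideals, phrased by divisibility in the domain. -/
def IsMaxT (M : Ideal D) : Prop := Maximal (fun I : Ideal D => I ≠ ⊥ ∧ I ≠ ⊤ ∧ IsTIdeal I) M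

/-- The `t`-closure of an integral ideal. -/
def tcl (I : Ideal D) : Ideal D where
  carrier := {x | ∃ J : Ideal D, J.FG ∧ J ≤ I ∧ x ∈ divClosure J}
  zero_mem' := ⟨⊥, Submodule.fg_bot, bot_le, zero_mem _⟩
  add_mem' := by
    rintro x y ⟨J, hJ, hJI, hx⟩ ⟨L, hL, hLI, hy⟩
    exact ⟨J ⊔ L, Submodule.FG.sup hJ hL, sup_le hJI hLI,
      add_mem (divClosure_mono le_sup_left hx) (divClosure_mono le_sup_right hy)⟩
  smul_mem' := by
    rintro r x ⟨J, hJ, hJI, hx⟩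
    exact ⟨J, hJ, hJI, Ideal.mul_mem_left _ r hx⟩

theorem mem_tcl {I : Ideal D} {x : D} :
    x ∈ tcl I ↔ ∃ J : Ideal D, J.FG ∧ J ≤ I ∧ x ∈ divClosure J := Iff.rfl

theorem le_tcl (I : Ideal D) : I ≤ tcl I := fun x hx =>
  ⟨Ideal.span {x}, ⟨{x}, by simp⟩, by simpa [Ideal.span_le] using hx,
    le_divClosure _ (Ideal.mem_span_singleton_self x)⟩

theorem exists_fg_le_of_le_tcl {I J : Ideal D} (hJ : J.FG) (h : J ≤ tcl I) :
    ∃ L : Ideal D, L.FG ∧ L ≤ I ∧ J ≤ divClosure L := by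
  obtain ⟨s, rfl⟩ := hJ
  have hs : ∀ x ∈ s, ∃ L : Ideal D, L.FG ∧ L ≤ I ∧ x ∈ divClosure L :=
    fun x hx => h (Ideal.subset_span hx)
  choose! L hL hLI hx using hs
  refine ⟨s.sup L, Submodule.fg_finset_sup s L hL, Finset.sup_le hLI, Ideal.span_le.2 ?_⟩
  exact fun x hxs => divClosure_mono (Finset.le_sup hxs) (hx x hxs)

theorem isTIdeal_tcl (I : Ideal D) : IsTIdeal (tcl I) := by
  intro J hJ hJI x hx
  obtain ⟨L, hL, hLI, hJL⟩ := exists_fg_le_of_le_tcl hJ hJI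
  exact ⟨L, hL, hLI, divClosure_le_of_le hJL hx⟩

/-- Zorn applies to the ideals L with 1 ∉ L_t: a finitely generated J inside the union of a chain
already lies in one member. A maximal such L equals its own t-closure. -/
theorem exists_isMaxT_le {I : Ideal D} (hI : I ≠ ⊥) (h1 : 1 ∉ tcl I) :
    ∃ M, IsMaxT M ∧ I ≤ M := by
  obtain ⟨M, hIM, hM⟩ := zorn_le_nonempty₀ {L : Ideal D | 1 ∉ tcl L} (by
    intro c hc hchain y hy
    refine ⟨sSup c, ?_, fun z hz => le_sSup hz⟩
    rintro ⟨J, hJ, hJc, h1J⟩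
    obtain ⟨z, hz, hJz⟩ := (CompleteLattice.isCompactElement_iff_le_of_directed_sSup_le _ J).1
      ((Submodule.fg_iff_compact J).1 hJ) c ⟨y, hy⟩ hchain.directedOn hJc
    exact hc hz ⟨J, hJ, hJz, h1J⟩) I h1
  have hle : tcl M ≤ M := hM.2 (y := tcl M) (fun h => hM.1 (by
    obtain ⟨J, hJ, hJM, h1J⟩ := h
    exact isTIdeal_tcl M J hJ hJM h1J)) (le_tcl M)
  refine ⟨M, ⟨⟨?_, ?_, fun J hJ hJM x hx => hle ⟨J, hJ, hJM, hx⟩⟩, ?_⟩, hIM⟩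
  · rintro rfl
    exact hI (le_bot_iff.1 hIM)
  · rintro rfl
    exact hM.1 (le_tcl _ trivial)
  · rintro L ⟨-, hLtop, hL⟩ hML
    refine hM.2 (y := L) ?_ hML
    rintro ⟨J, hJ, hJL, h1J⟩
    exact hLtop ((Ideal.eq_top_iff_one L).2 (hL J hJ hJL h1J))

theorem exists_fg_of_forall_not_le {I : Ideal D} (hI : I ≠ ⊥) (h : ∀ M, IsMaxT M → ¬ I ≤ M) :
    ∃ J : Ideal D, J.FG ∧ J ≤ I ∧ 1 ∈ divClosure J := by
  by_contra h1
  obtain ⟨M, hM, hIM⟩ := exists_isMaxT_le hI h1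
  exact h M hM hIM

namespace IsMaxT

variable {M : Ideal D}

theorem ne_bot (hM : IsMaxT M) : M ≠ ⊥ := hM.1.1

theorem ne_top (hM : IsMaxT M) : M ≠ ⊤ := hM.1.2.1

theorem isTIdeal (hM : IsMaxT M) : IsTIdeal M := hM.1.2.2

theorem eq_of_le (hM : IsMaxT M) {N : Ideal D} (hN : IsMaxT N) (h : M ≤ N) : M = N :=
  le_antisymm h (hM.2 hN.1 h)

theorem one_notMem_divClosure (hM : IsMaxT M) {J : Ideal D} (hJ : J.FG) (h : J ≤ M) :
    1 ∉ divClosure J := fun h1 =>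
  hM.ne_top ((Ideal.eq_top_iff_one M).2 (hM.isTIdeal J hJ h h1))

theorem exists_fg_of_lt (hM : IsMaxT M) {I : Ideal D} (h : M < I) :
    ∃ J : Ideal D, J.FG ∧ J ≤ I ∧ 1 ∈ divClosure J := by
  refine exists_fg_of_forall_not_le (fun hI => not_lt_bot (hI ▸ h)) fun N hN hIN => ?_
  exact (h.trans_le hIN).ne (hM.eq_of_le hN (h.le.trans hIN))

theorem exists_fg_of_notMem (hM : IsMaxT M) {s : D} (hs : s ∉ M) :
    ∃ J : Ideal D, J.FG ∧ J ≤ M ⊔ Ideal.span {s} ∧ 1 ∈ divClosure J := by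
  refine hM.exists_fg_of_lt (lt_of_le_of_ne le_sup_left fun h => hs ?_)
  rw [h]
  exact Ideal.mem_sup_right (Ideal.mem_span_singleton_self s)

/-- If ab ∈ M and a ∉ M, some finitely generated J ⊆ M + aD has J_v = D. Then bJ ⊆ M, so b ∈ (bJ)_v
⊆ M. -/
theorem isPrime (hM : IsMaxT M) : M.IsPrime := by
  refine ⟨hM.ne_top, fun {a b} hab => or_iff_not_imp_left.2 fun ha => ?_⟩
  obtain ⟨J, hJ, hJM, h1⟩ := hM.exists_fg_of_notMem ha
  refine hM.isTIdeal (J * Ideal.span {b}) (hJ.mul ⟨{b}, by simp⟩) ?_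
    (mem_divClosure_of_mul_mem h1 fun j hj => le_divClosure _ ?_)
  · refine Ideal.mul_le.2 fun j hj c hc => ?_
    obtain ⟨d, rfl⟩ := Ideal.mem_span_singleton.1 hc
    obtain ⟨m, hm, e, he, rfl⟩ := Submodule.mem_sup.1 (hJM hj)
    obtain ⟨k, rfl⟩ := Ideal.mem_span_singleton.1 he
    have : (m + a * k) * (b * d) = m * (b * d) + (k * d) * (a * b) := by ring
    rw [this]
    exact add_mem (M.mul_mem_right _ hm) (M.mul_mem_left _ hab)
  · rw [mul_comm b j]
    exact Ideal.mul_mem_mul hj (Ideal.mem_span_singleton_self b)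

/-- This is M^n D_M ∩ D ⊆ (M^n)_v. Take J ⊆ M + sD with J_v = D; then J^n ⊆ M^n + sD, so x J^n ⊆
M^n, while (J^n)_v = D. -/
theorem mem_divClosure_pow (hM : IsMaxT M) {s x : D} {n : ℕ} (hs : s ∉ M)
    (hsx : s * x ∈ M ^ n) : x ∈ divClosure (M ^ n) := by
  obtain ⟨J, hJ, hJM, h1⟩ := hM.exists_fg_of_notMem hs
  refine mem_divClosure_of_mul_mem (one_mem_divClosure_pow h1 n) fun j hj => le_divClosure _ ?_
  have hj' : j ∈ M ^ n ⊔ Ideal.span {s} := by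
    exact sup_pow_le_pow_sup _ _ n (Ideal.pow_right_mono hJM n hj)
  obtain ⟨m, hm, e, he, rfl⟩ := Submodule.mem_sup.1 hj'
  obtain ⟨k, rfl⟩ := Ideal.mem_span_singleton.1 he
  have : x * (m + s * k) = x * m + k * (s * x) := by ring
  rw [this]
  exact add_mem (Ideal.mul_mem_left _ _ hm) (Ideal.mul_mem_left _ _ hsx)

end IsMaxT

end Closure

/-! ### Local orders, finite character and primes at regular maximal t-ideals -/

section Regular

variable {D : Type*} [CommRing D]

/-- An ideal `M` with an element `m ∈ M` which generates `M` locally at `N`. -/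
def LocallyPrincipalAt (M N : Ideal D) : Prop := ∃ m ∈ M, ∃ u ∉ N, ∀ j ∈ M, m ∣ u * j

theorem pow_dvd_of_forall_dvd {M : Ideal D} {m u : D} (h : ∀ j ∈ M, m ∣ u * j) (n : ℕ) :
    ∀ j ∈ M ^ n, m ^ n ∣ u ^ n * j := by
  induction n with
  | zero => simp
  | succ n ih =>
    intro j hj
    rw [pow_succ] at hj
    induction hj using Submodule.mul_induction_on' with
    | mem_mul_mem a ha b hb =>
      have : u ^ (n + 1) * (a * b) = (u ^ n * a) * (u * b) := by ring
      rw [this, pow_succ]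
      exact mul_dvd_mul (ih a ha) (h b hb)
    | add a _ b _ ha hb =>
      rw [mul_add]
      exact dvd_add ha hb

/-- A maximal `t`-ideal which is principal locally at itself, with separated divisorial powers. -/
structure IsRegular (M : Ideal D) : Prop where
  isMaxT : IsMaxT M
  locallyPrincipal : LocallyPrincipalAt M M
  separated : ∀ x : D, (∀ n : ℕ, 1 ≤ n → x ∈ divClosure (M ^ n)) → x = 0

/-- `m` is a local uniformizer at `M`, as witnessed by `u`. -/
structure IsUniformizer (M : Ideal D) (m u : D) : Prop where
  mem : m ∈ M
  notMem : u ∉ M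
  dvd : ∀ j ∈ M, m ∣ u * j

namespace IsRegular

variable {M : Ideal D}

theorem exists_isUniformizer (hM : IsRegular M) : ∃ m u, IsUniformizer M m u := by
  obtain ⟨m, hm, u, hu, h⟩ := hM.locallyPrincipal
  exact ⟨m, u, hm, hu, h⟩

theorem uniformizer_ne_zero [IsDomain D] (hM : IsRegular M) {m u : D} (h : IsUniformizer M m u) : m ≠ 0 := by
  rintro rfl
  refine hM.isMaxT.ne_bot ((Submodule.eq_bot_iff _).2 fun j hj => ?_)
  have h0 := zero_dvd_iff.1 (h.dvd j hj)
  exact (mul_eq_zero.1 h0).resolve_left fun hu => h.notMem (hu ▸ M.zero_mem)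

/-- If every m^n divided x locally at M, then x would lie in every (M^n)_v and vanish. The exponent
is the last one that works. -/
theorem exists_factorization (hM : IsRegular M) {m u : D} (h : IsUniformizer M m u) {x : D}
    (hx : x ≠ 0) : ∃ n : ℕ, ∃ s ∉ M, ∃ t ∉ M, s * x = t * m ^ n := by
  classical
  have hP := hM.isMaxT.isPrime
  have hex : ∃ n : ℕ, ¬ ∃ s ∉ M, m ^ n ∣ s * x := by
    by_contra! hall
    refine hx (hM.separated x fun n _ => ?_)
    obtain ⟨s, hs, hd⟩ := hall n
    exact hM.isMaxT.mem_divClosure_pow hs ((M ^ n).mem_of_dvd hd (Ideal.pow_mem_pow h.mem n))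
  obtain ⟨n, hn⟩ : ∃ n, Nat.find hex = n + 1 := by
    refine Nat.exists_eq_succ_of_ne_zero fun h0 => ?_
    refine (h0 ▸ Nat.find_spec hex) ⟨1, hP.one_notMem, by simp⟩
  obtain ⟨s, hs, t, ht⟩ := not_not.1 (Nat.find_min hex (by omega : n < Nat.find hex))
  refine ⟨n, s, hs, t, fun htM => ?_, by rw [ht, mul_comm]⟩
  have hspec := Nat.find_spec hex
  rw [hn] at hspec
  -- If t were in M, it would contribute one more local factor m.
  obtain ⟨k, hk⟩ := h.dvd t htM
  refine hspec ⟨u * s, hP.mul_notMem h.notMem hs, k, ?_⟩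
  rw [mul_assoc, ht, pow_succ, mul_assoc, ← hk]
  ring

theorem eq_of_isPrime_le [IsDomain D] (hM : IsRegular M) {P : Ideal D} [P.IsPrime] (hP : P ≠ ⊥)
    (hPM : P ≤ M) : P = M := by
  refine le_antisymm hPM fun j hj => ?_
  obtain ⟨m, u, h⟩ := hM.exists_isUniformizer
  obtain ⟨x, hxP, hx⟩ := Submodule.exists_mem_ne_zero_of_ne_bot hP
  obtain ⟨n, s, hs, t, ht, hst⟩ := hM.exists_factorization h hx
  have hmem : t * m ^ n ∈ P := hst ▸ P.mul_mem_left s hxP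
  have hm : m ∈ P := Ideal.IsPrime.mem_of_pow_mem ‹_› n
    ((Ideal.IsPrime.mem_or_mem ‹_› hmem).resolve_left fun h => ht (hPM h))
  exact (Ideal.IsPrime.mem_or_mem ‹_› (P.mem_of_dvd (h.dvd j hj) hm)).resolve_left
    fun hu => h.notMem (hPM hu)

/-- Take f = (u/m)^n x with n the order of x at M. It lies in D because (u/m)^n ∈ (M^n)⁻¹ and x ∈
(M^n)_v, and dividing out m^n leaves it outside M. -/
theorem exists_mem_iff_eq [IsDomain D] (hM : IsRegular M) {x : D} (hx : x ≠ 0) :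
    ∃ f ∉ M, ∀ N, IsRegular N → x ∈ N → N ≠ M → f ∈ N := by
  obtain ⟨m, u, h⟩ := hM.exists_isUniformizer
  have hm0 := hM.uniformizer_ne_zero h
  have hP := hM.isMaxT.isPrime
  obtain ⟨n, s, hs, t, ht, hst⟩ := hM.exists_factorization h hx
  have hxn : x ∈ divClosure (M ^ n) := hM.isMaxT.mem_divClosure_pow hs
    (hst ▸ Ideal.mul_mem_left _ t (Ideal.pow_mem_pow h.mem n))
  obtain ⟨f, hf⟩ := hxn (u ^ n) (m ^ n) (pow_dvd_of_forall_dvd h.dvd n)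
  refine ⟨f, fun hfM => ?_, fun N hN hxN hNM => ?_⟩
  · have hsf : s * f = t * u ^ n := by
      refine mul_left_cancel₀ (pow_ne_zero n hm0) ?_
      linear_combination u ^ n * hst - s * hf
    refine hP.mul_notMem ht (fun h' => h.notMem (hP.mem_of_pow_mem n h')) ?_
    exact hsf ▸ M.mul_mem_left s hfM
  · have hNP := hN.isMaxT.isPrime
    -- For c ∈ M outside N, c^n (u/m)^n ∈ D, so c^n f is a multiple of x and f ∈ N.
    obtain ⟨c, hcM, hcN⟩ := SetLike.not_le_iff_exists.1
      fun hle => hNM (hM.isMaxT.eq_of_le hN.isMaxT hle).symm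
    obtain ⟨e, he⟩ := pow_dvd_of_forall_dvd h.dvd n (c ^ n) (Ideal.pow_mem_pow hcM n)
    have hcf : c ^ n * f = x * e := by
      refine mul_left_cancel₀ (pow_ne_zero n hm0) ?_
      linear_combination x * he - c ^ n * hf
    exact (hNP.mem_or_mem (hcf ▸ N.mul_mem_right e hxN)).resolve_left
      fun h' => hcN (hNP.mem_of_pow_mem n h')

end IsRegular

/-- The colon ideal (b : a) lies in no maximal t-ideal, so it contains some J with J_v = D, and b ∣
aJ gives b ∣ a. -/
theorem dvd_of_forall_isMaxT {a b : D} (hb : b ≠ 0)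
    (h : ∀ M : Ideal D, IsMaxT M → ∃ s ∉ M, b ∣ s * a) : b ∣ a := by
  let B : Ideal D := (Ideal.span {b}).colon {a}
  have hB : ∀ s, s ∈ B ↔ b ∣ s * a := fun s => by
    simp [B, Submodule.mem_colon_singleton, Ideal.mem_span_singleton]
  obtain ⟨J, -, hJB, h1⟩ := exists_fg_of_forall_not_le (I := B)
    (fun h => hb (by simpa [h] using (hB b).2 (dvd_mul_right _ _))) fun M hM hBM => by
    obtain ⟨s, hs, hsx⟩ := h M hM
    exact hs (hBM ((hB s).2 hsx))
  simpa using h1 a b fun j hj => by simpa [mul_comm] using (hB j).1 (hJB hj)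

/-- The f avoided by only finitely many maximal t-ideals through x form an ideal A, and
`exists_mem_iff_eq` shows A lies in no maximal t-ideal. So A contains a finitely generated J with
J_v = D, and each maximal t-ideal through x misses one of its generators. -/
theorem finite_isMaxT_mem [IsDomain D] (hreg : ∀ M : Ideal D, IsMaxT M → IsRegular M)
    {x : D} (hx : x ≠ 0) : {N : Ideal D | IsMaxT N ∧ x ∈ N}.Finite := by
  let A : Ideal D :=
    { carrier := {f | {N : Ideal D | (IsMaxT N ∧ x ∈ N) ∧ f ∉ N}.Finite}
      zero_mem' := by simp
      add_mem' := fun {f g} hf hg => (hf.union hg).subset fun N hN => by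
        by_contra hcon
        simp only [Set.mem_union, Set.mem_ofPred_eq, not_or, not_and, not_not] at hcon
        exact hN.2 (add_mem (hcon.1 hN.1) (hcon.2 hN.1))
      smul_mem' := fun r f hf => hf.subset fun N hN =>
        ⟨hN.1, fun h => hN.2 (N.mul_mem_left r h)⟩ }
  have hA : ∀ f, f ∈ A ↔ {N : Ideal D | (IsMaxT N ∧ x ∈ N) ∧ f ∉ N}.Finite := fun _ => Iff.rfl
  have hxA : x ∈ A := (hA x).2 (Set.finite_empty.subset fun N hN => hN.2 hN.1.2)
  obtain ⟨J, ⟨S, rfl⟩, hJA, h1⟩ := exists_fg_of_forall_not_le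
    (I := A) (fun h => hx (by simpa [h] using hxA)) fun M hM hAM => by
    obtain ⟨f, hfM, hf⟩ := (hreg M hM).exists_mem_iff_eq hx
    refine hfM (hAM ((hA f).2 ((Set.finite_singleton M).subset fun N hN => ?_)))
    by_contra hNM
    exact hN.2 (hf N (hreg N hN.1.1) hN.1.2 hNM)
  refine (S.finite_toSet.biUnion fun f hf => (hA f).1 (hJA (Ideal.subset_span hf))).subset ?_
  intro N hN
  by_contra hcon
  simp only [Set.mem_iUnion, not_exists] at hcon
  refine hN.1.one_notMem_divClosure ⟨S, rfl⟩ (Ideal.span_le.2 fun f hf => ?_) h1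
  by_contra hfN
  exact hcon f hf ⟨hN, hfN⟩

theorem exists_isMaxT_le_of_isPrime [IsDomain D]
    (hreg : ∀ M : Ideal D, IsMaxT M → IsRegular M)
    {P : Ideal D} [hP : P.IsPrime] (hP0 : P ≠ ⊥) :
    ∃ M, IsMaxT M ∧ M ≤ P := by
  classical
  obtain ⟨x, hxP, hx⟩ := Submodule.exists_mem_ne_zero_of_ne_bot hP0
  by_contra! hcon
  have hfin := finite_isMaxT_mem hreg hx
  -- The choice is total, with g = 1 off the maximal t-ideals, so that a finite product can be
  -- formed.
  have key : ∀ M : Ideal D, ∃ g ∉ P, IsMaxT M → ∃ s ∉ M, x ∣ s * g := by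
    intro M
    by_cases hM : IsMaxT M
    · obtain ⟨a, haM, haP⟩ := SetLike.not_le_iff_exists.1 (hcon M hM)
      obtain ⟨m, u, h⟩ := (hreg M hM).exists_isUniformizer
      obtain ⟨n, s, hs, t, ht, hst⟩ := (hreg M hM).exists_factorization h hx
      obtain ⟨e, he⟩ := pow_dvd_of_forall_dvd h.dvd n (a ^ n) (Ideal.pow_mem_pow haM n)
      have := hM.isPrime
      -- With n the order of x at M, a^n ∈ x D_M because a ∈ M.
      refine ⟨a ^ n, fun h' => haP (hP.mem_of_pow_mem n h'), fun _ => ⟨t * u ^ n, ?_, s * e, ?_⟩⟩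
      · exact this.mul_notMem ht fun h' => h.notMem (this.mem_of_pow_mem n h')
      · linear_combination t * he - e * hst
    · exact ⟨1, hP.one_notMem, fun h => absurd h hM⟩
  choose g hgP hg using key
  let G := ∏ M ∈ hfin.toFinset, g M
  have hG : G ∉ P := fun h => by
    obtain ⟨M, -, hM⟩ := (hP.prod_mem_iff).1 h
    exact hgP M hM
  refine hG (P.mem_of_dvd (dvd_of_forall_isMaxT hx fun M hM => ?_) hxP)
  by_cases hxM : x ∈ M
  · obtain ⟨s, hs, hsx⟩ := hg M hM
    exact ⟨s, hs, hsx.trans (mul_dvd_mul_left s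
      (Finset.dvd_prod_of_mem g (hfin.mem_toFinset.2 ⟨hM, hxM⟩)))⟩
  · exact ⟨x, hxM, dvd_mul_right _ _⟩

theorem iInf_pow_eq_bot_iff (M : Ideal D) :
    (⨅ n : ℕ, ⨅ _ : 1 ≤ n, M ^ n) = ⊥ ↔ ∀ x : D, (∀ n : ℕ, 1 ≤ n → x ∈ M ^ n) → x = 0 := by
  simp [Submodule.eq_bot_iff, Submodule.mem_iInf]

end Regular

/-! ### Translation to fractional ideals -/

section FractionField

variable {D : Type*} (K : Type*) [CommRing D] [Field K] [Algebra D K]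
  [IsFractionRing D K]

theorem dvd_iff_div_mem_one {b c : D} (hc : c ≠ 0) :
    c ∣ b ↔ algebraMap D K b / algebraMap D K c ∈ (1 : FractionalIdeal D⁰ K) := by
  have hc' : algebraMap D K c ≠ 0 := by simpa using hc
  rw [FractionalIdeal.mem_one_iff]
  constructor
  · rintro ⟨k, rfl⟩
    exact ⟨k, by rw [map_mul, mul_div_cancel_left₀ _ hc']⟩
  · rintro ⟨k, hk⟩
    rw [eq_div_iff hc', ← map_mul] at hk
    exact ⟨k, by rw [mul_comm, IsFractionRing.injective D K hk]⟩

variable {K} in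
theorem dvd_iff_forall_mem {F : Set (ValuationSubring K)}
    (hF : ∀ x : K, x ∈ Set.range (algebraMap D K) ↔ ∀ V ∈ F, x ∈ V) {b c : D} (hc : c ≠ 0) :
    c ∣ b ↔ ∀ V ∈ F, algebraMap D K b / algebraMap D K c ∈ V := by
  rw [dvd_iff_div_mem_one K hc, FractionalIdeal.mem_one_iff, ← hF]
  rfl

variable [IsDomain D]

theorem one_mem_inv_coeIdeal {J : Ideal D} (hJ : J ≠ ⊥) :
    (1 : K) ∈ (J : FractionalIdeal D⁰ K)⁻¹ := by
  rw [FractionalIdeal.mem_inv_iff (FractionalIdeal.coeIdeal_ne_zero.2 hJ)]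
  intro y hy
  rw [one_mul]
  exact FractionalIdeal.coeIdeal_le_one hy

theorem div_mem_inv_coeIdeal_iff {J : Ideal D} (hJ : J ≠ ⊥) {b c : D} (hc : c ≠ 0) :
    algebraMap D K b / algebraMap D K c ∈ (J : FractionalIdeal D⁰ K)⁻¹ ↔ ∀ j ∈ J, c ∣ b * j := by
  rw [FractionalIdeal.mem_inv_iff (FractionalIdeal.coeIdeal_ne_zero.2 hJ)]
  constructor
  · intro h j hj
    rw [dvd_iff_div_mem_one K hc, map_mul, mul_div_right_comm]
    exact h _ (FractionalIdeal.mem_coeIdeal_of_mem _ hj)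
  · intro h y hy
    obtain ⟨j, hj, rfl⟩ := (FractionalIdeal.mem_coeIdeal _).1 hy
    rw [← mul_div_right_comm, ← map_mul, ← dvd_iff_div_mem_one K hc]
    exact h j hj

theorem vClosure_coeIdeal (J : Ideal D) :
    vClosure (J : FractionalIdeal D⁰ K) = (divClosure J : Ideal D) := by
  by_cases hJ : J = ⊥
  · subst hJ
    simp [divClosure_bot, vClosure, FractionalIdeal.inv_zero']
  have hinv : (J : FractionalIdeal D⁰ K)⁻¹ ≠ 0 := fun h => by
    simpa [h] using one_mem_inv_coeIdeal K hJ
  have key : ∀ x : D, algebraMap D K x ∈ vClosure (J : FractionalIdeal D⁰ K) ↔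
      x ∈ divClosure J := by
    intro x
    rw [vClosure, FractionalIdeal.mem_inv_iff hinv]
    constructor
    · intro h b c hbc
      -- The pair with c = 0 is no fraction, but it forces b = 0 since J has a nonzero element.
      by_cases hc : c = 0
      · obtain ⟨j, hj, hj0⟩ := Submodule.exists_mem_ne_zero_of_ne_bot hJ
        subst hc
        have := (mul_eq_zero.1 (zero_dvd_iff.1 (hbc j hj))).resolve_right hj0
        simp [this]
      · rw [mul_comm, dvd_iff_div_mem_one K hc, map_mul, mul_div_assoc]
        exact h _ ((div_mem_inv_coeIdeal_iff K hJ hc).2 hbc)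
    · intro h z hz
      obtain ⟨b, c, hc, rfl⟩ := IsFractionRing.div_surjective (A := D) z
      have hc0 := nonZeroDivisors.ne_zero hc
      rw [← mul_div_assoc, ← map_mul, ← dvd_iff_div_mem_one K hc0, mul_comm]
      exact h b c ((div_mem_inv_coeIdeal_iff K hJ hc0).1 hz)
  have hle : vClosure (J : FractionalIdeal D⁰ K) ≤ 1 := by
    refine (vClosure_mono FractionalIdeal.coeIdeal_le_one).trans_eq ?_
    simp [vClosure]
  ext y
  rw [FractionalIdeal.mem_coeIdeal]
  constructor
  · intro hy
    obtain ⟨x, rfl⟩ := (FractionalIdeal.mem_one_iff _).1 (hle hy)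
    exact ⟨x, (key x).1 hy, rfl⟩
  · rintro ⟨x, hx, rfl⟩
    exact (key x).2 hx

theorem tClosure_coeIdeal (I : Ideal D) :
    tClosure (I : FractionalIdeal D⁰ K) = (tcl I : Ideal D) := by
  ext y
  rw [FractionalIdeal.mem_coeIdeal]
  constructor
  · rintro ⟨J, hJ, hJI, hy⟩
    obtain ⟨L, rfl⟩ := FractionalIdeal.le_one_iff_exists_coeIdeal.1
      (hJI.trans FractionalIdeal.coeIdeal_le_one)
    rw [vClosure_coeIdeal, FractionalIdeal.mem_coeIdeal] at hy
    obtain ⟨x, hx, rfl⟩ := hy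
    exact ⟨x, ⟨L, (FractionalIdeal.coeIdeal_fg _ (IsFractionRing.injective D K) L).1 hJ,
      (FractionalIdeal.coeIdeal_le_coeIdeal K).1 hJI, hx⟩, rfl⟩
  · rintro ⟨x, ⟨J, hJ, hJI, hx⟩, rfl⟩
    refine ⟨J, (FractionalIdeal.coeIdeal_fg _ (IsFractionRing.injective D K) J).2 hJ,
      (FractionalIdeal.coeIdeal_le_coeIdeal K).2 hJI, ?_⟩
    rw [vClosure_coeIdeal]
    exact FractionalIdeal.mem_coeIdeal_of_mem _ hx

theorem tClosure_coeIdeal_eq_iff (I : Ideal D) :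
    tClosure (I : FractionalIdeal D⁰ K) = (I : FractionalIdeal D⁰ K) ↔ IsTIdeal I := by
  rw [tClosure_coeIdeal, FractionalIdeal.coeIdeal_inj]
  exact ⟨fun h => h ▸ isTIdeal_tcl I,
    fun h => le_antisymm (fun x ⟨J, hJ, hJI, hx⟩ => h J hJ hJI hx) (le_tcl I)⟩

theorem isMaximalTIdeal_iff {M : Ideal D} : IsMaximalTIdeal K M ↔ IsMaxT M := by
  simp only [IsMaximalTIdeal, IsMaxT, tClosure_coeIdeal_eq_iff]

/-- M M⁻¹ escapes N exactly when some m z = u ∉ N with m ∈ M, z ∈ M⁻¹; then z = u/m, that is, m ∣ u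
j on M. Both notions of invertibility thereby become local. -/
theorem exists_coeIdeal_eq_mul_inv {M : Ideal D} (hM : M ≠ ⊥) :
    ∃ A : Ideal D, (A : FractionalIdeal D⁰ K) =
      (M : FractionalIdeal D⁰ K) * (M : FractionalIdeal D⁰ K)⁻¹ ∧ M ≤ A ∧
      ∀ N : Ideal D, ¬ A ≤ N ↔ LocallyPrincipalAt M N := by
  have hM' := (FractionalIdeal.coeIdeal_ne_zero (K := K)).2 hM
  obtain ⟨A, hA⟩ : ∃ A : Ideal D, (A : FractionalIdeal D⁰ K) =
      (M : FractionalIdeal D⁰ K) * (M : FractionalIdeal D⁰ K)⁻¹ := by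
    refine FractionalIdeal.le_one_iff_exists_coeIdeal.1 (FractionalIdeal.mul_le.2 ?_)
    intro i hi z hz
    rw [mul_comm]
    exact (FractionalIdeal.mem_inv_iff hM').1 hz i hi
  refine ⟨A, hA, fun j hj => ?_, fun N => ⟨fun h => ?_, ?_⟩⟩
  · have : algebraMap D K j * 1 ∈ (A : FractionalIdeal D⁰ K) :=
      hA ▸ FractionalIdeal.mul_mem_mul (FractionalIdeal.mem_coeIdeal_of_mem _ hj)
        (one_mem_inv_coeIdeal K hM)
    obtain ⟨k, hk, hkj⟩ := (FractionalIdeal.mem_coeIdeal _).1 this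
    rw [mul_one] at hkj
    exact IsFractionRing.injective D K hkj ▸ hk
  · rw [← FractionalIdeal.coeIdeal_le_coeIdeal K, hA, FractionalIdeal.mul_le] at h
    push Not at h
    obtain ⟨i, hi, z, hz, hiz⟩ := h
    obtain ⟨m, hm, rfl⟩ := (FractionalIdeal.mem_coeIdeal _).1 hi
    rw [FractionalIdeal.mem_inv_iff hM'] at hz
    obtain ⟨u, hu⟩ := (FractionalIdeal.mem_one_iff _).1 (hz _ hi)
    refine ⟨m, hm, u, fun huN => hiz ?_, fun j hj => ?_⟩
    · rw [mul_comm, ← hu]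
      exact FractionalIdeal.mem_coeIdeal_of_mem _ huN
    · obtain ⟨k, hk⟩ := (FractionalIdeal.mem_one_iff _).1
        (hz _ (FractionalIdeal.mem_coeIdeal_of_mem _ hj))
      refine ⟨k, IsFractionRing.injective D K ?_⟩
      rw [map_mul, map_mul, hk, hu]
      ring
  · rintro ⟨m, hm, u, hu, h⟩ hAN
    by_cases hm0 : m = 0
    · obtain ⟨j, hj, hj0⟩ := Submodule.exists_mem_ne_zero_of_ne_bot hM
      subst hm0
      have := (mul_eq_zero.1 (zero_dvd_iff.1 (h j hj))).resolve_right hj0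
      exact hu (this ▸ N.zero_mem)
    · have := FractionalIdeal.mul_mem_mul (FractionalIdeal.mem_coeIdeal_of_mem D⁰ hm)
        ((div_mem_inv_coeIdeal_iff K hM hm0).2 h)
      rw [mul_div_cancel₀ _ (by simpa using hm0), ← hA] at this
      obtain ⟨k, hk, hku⟩ := (FractionalIdeal.mem_coeIdeal _).1 this
      exact hu (hAN (IsFractionRing.injective D K hku ▸ hk))

theorem isInvertibleIdeal_iff {M : Ideal D} (hM : M ≠ ⊥) :
    IsInvertibleIdeal K M ↔ ∀ N : Ideal D, N.IsMaximal → LocallyPrincipalAt M N := by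
  obtain ⟨A, hA, -, h⟩ := exists_coeIdeal_eq_mul_inv K hM
  simp only [IsInvertibleIdeal, ← hA, FractionalIdeal.coeIdeal_eq_one, Ideal.one_eq_top, ← h]
  constructor
  · rintro rfl N hN hle
    exact hN.ne_top (top_le_iff.1 hle)
  · intro hN
    by_contra hA'
    obtain ⟨N, hNmax, hle⟩ := Ideal.exists_le_maximal A hA'
    exact hN N hNmax hle

/-- Since M ⊆ M M⁻¹, the only maximal t-ideal that can contain M M⁻¹ is M. -/
theorem isTInvertibleIdeal_iff {M : Ideal D} (hM : IsMaxT M) :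
    IsTInvertibleIdeal K M ↔ LocallyPrincipalAt M M := by
  obtain ⟨A, hA, hMA, h⟩ := exists_coeIdeal_eq_mul_inv K hM.ne_bot
  rw [IsTInvertibleIdeal, ← hA, ← h, tClosure_coeIdeal, FractionalIdeal.coeIdeal_eq_one,
    Ideal.one_eq_top, Ideal.eq_top_iff_one, mem_tcl]
  constructor
  · rintro ⟨J, hJ, hJA, h1⟩ hAM
    exact hM.one_notMem_divClosure hJ (hJA.trans hAM) h1
  · intro hAM
    refine exists_fg_of_forall_not_le (fun hA0 => hAM (hA0 ▸ bot_le)) fun N hN hAN => hAM ?_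
    rwa [hM.eq_of_le hN (hMA.trans hAN)]

theorem iInf_vClosure_pow_eq_bot_iff (M : Ideal D) :
    (⨅ n : ℕ, ⨅ _ : 1 ≤ n,
      (vClosure ((M ^ n : Ideal D) : FractionalIdeal D⁰ K) : Submodule D K)) = ⊥ ↔
    ∀ x : D, (∀ n : ℕ, 1 ≤ n → x ∈ divClosure (M ^ n)) → x = 0 := by
  simp only [vClosure_coeIdeal, Submodule.eq_bot_iff, Submodule.mem_iInf,
    FractionalIdeal.mem_coe, FractionalIdeal.mem_coeIdeal]
  constructor
  · intro h x hx
    simpa using h (algebraMap D K x) fun n hn => ⟨x, hx n hn, rfl⟩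
  · intro h y hy
    -- The term n = 1 already places y in D.
    obtain ⟨x, -, rfl⟩ := hy 1 le_rfl
    rw [h x fun n hn => ?_, map_zero]
    obtain ⟨x', hx', hxx⟩ := hy n hn
    exact IsFractionRing.injective D K hxx ▸ hx'

theorem isRegular_iff {M : Ideal D} (hM : IsMaxT M) :
    IsRegular M ↔ IsTInvertibleIdeal K M ∧
      (⨅ n : ℕ, ⨅ _ : 1 ≤ n,
        (vClosure ((M ^ n : Ideal D) : FractionalIdeal D⁰ K) : Submodule D K)) = ⊥ := by
  rw [isTInvertibleIdeal_iff K hM, iInf_vClosure_pow_eq_bot_iff]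
  exact ⟨fun h => ⟨h.2, h.3⟩, fun h => ⟨hM, h.1, h.2⟩⟩

end FractionField

/-! ### Discrete valuation rings of the quotient field -/

section DiscreteValuation

variable {K : Type*} [Field K] (V : ValuationSubring K)

theorem isUnit_iff_inv_mem {x : V} (hx : x ≠ 0) : IsUnit x ↔ (x : K)⁻¹ ∈ V := by
  have hx' : (x : K) ≠ 0 := by simpa using hx
  rw [isUnit_iff_exists_inv]
  constructor
  · rintro ⟨y, hy⟩
    have : (x : K) * y = 1 := by simpa using congrArg Subtype.val hy
    rw [inv_eq_of_mul_eq_one_right this]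
    exact y.2
  · exact fun h => ⟨⟨_, h⟩, Subtype.ext (mul_inv_cancel₀ hx')⟩

/-- If z ∉ V, then z⁻¹ is a nonunit of V all of whose powers divide x ≠ 0. -/
theorem mem_of_forall_pow_mul_mem [IsDiscreteValuationRing V] {x z : K} (hx : x ≠ 0)
    (h : ∀ n : ℕ, z ^ n * x ∈ V) : z ∈ V := by
  by_contra hz
  have hz0 : z ≠ 0 := fun h0 => hz (h0 ▸ V.zero_mem)
  let w : V := ⟨z⁻¹, (V.mem_or_inv_mem z).resolve_left hz⟩
  have hw : ¬ IsUnit w := by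
    rw [isUnit_iff_inv_mem V fun h0 => inv_ne_zero hz0 (congrArg Subtype.val h0)]
    simpa [w] using hz
  let X : V := ⟨x, by simpa using h 0⟩
  obtain ⟨n, hn⟩ := FiniteMultiplicity.of_not_isUnit hw
    (b := X) fun h0 => hx (congrArg Subtype.val h0)
  refine hn ⟨⟨_, h (n + 1)⟩, Subtype.ext ?_⟩
  change x = z⁻¹ ^ (n + 1) * (z ^ (n + 1) * x)
  rw [← mul_assoc, ← mul_pow, inv_mul_cancel₀ hz0, one_pow, one_mul]

theorem exists_forall_mem_eq_mul {D : Type*} [CommRing D] [IsDomain D] [Algebra D K]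
    [FaithfulSMul D K] [IsDiscreteValuationRing V] (hV : ∀ d : D, algebraMap D K d ∈ V)
    {I : Ideal D} (hI : I ≠ ⊥) :
    ∃ y ∈ I, y ≠ 0 ∧ ∀ i ∈ I, ∃ v ∈ V, algebraMap D K i = algebraMap D K y * v := by
  let f : D → ℕ∞ := fun d => IsDiscreteValuationRing.addVal V ⟨algebraMap D K d, hV d⟩
  have hne : (I : Set D).Nonempty := ⟨0, I.zero_mem⟩
  have key : ∀ i ∈ I, ∃ v ∈ V,
      algebraMap D K i = algebraMap D K (Function.argminOn f I hne) * v := by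
    intro i hi
    obtain ⟨v, hv⟩ := (IsDiscreteValuationRing.addVal_le_iff_dvd (R := V)).1
      (Function.argminOn_le f (I : Set D) hi)
    exact ⟨v, v.2, congrArg Subtype.val hv⟩
  refine ⟨_, Function.argminOn_mem f I hne, fun h0 => ?_, key⟩
  obtain ⟨i, hi, hi0⟩ := Submodule.exists_mem_ne_zero_of_ne_bot hI
  obtain ⟨v, -, hv⟩ := key i hi
  rw [h0, map_zero, zero_mul] at hv
  exact hi0 (by simpa using hv)

end DiscreteValuation

/-! ### Krull domains and regular maximal t-ideals -/

section Krull

variable {D : Type*} (K : Type*) [CommRing D] [IsDomain D] [Field K] [Algebra D K]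
  [IsFractionRing D K]

/-- The localization at a regular maximal `t`-ideal, as a valuation subring of the
fraction field. -/
def localizationSubring {M : Ideal D} (hM : IsRegular M) : ValuationSubring K where
  carrier := {y | ∃ a, ∃ s ∉ M, y * algebraMap D K s = algebraMap D K a}
  zero_mem' := ⟨0, 1, hM.isMaxT.isPrime.one_notMem, by simp⟩
  one_mem' := ⟨1, 1, hM.isMaxT.isPrime.one_notMem, by simp⟩
  add_mem' := by
    rintro x y ⟨a, s, hs, hx⟩ ⟨b, t, ht, hy⟩
    refine ⟨a * t + b * s, s * t, hM.isMaxT.isPrime.mul_notMem hs ht, ?_⟩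
    simp only [map_add, map_mul, ← hx, ← hy]
    ring
  mul_mem' := by
    rintro x y ⟨a, s, hs, hx⟩ ⟨b, t, ht, hy⟩
    refine ⟨a * b, s * t, hM.isMaxT.isPrime.mul_notMem hs ht, ?_⟩
    simp only [map_mul, ← hx, ← hy]
    ring
  neg_mem' := by
    rintro x ⟨a, s, hs, hx⟩
    exact ⟨-a, s, hs, by simp [← hx]⟩
  mem_or_inv_mem' := by
    intro y
    obtain ⟨a, b, hb, rfl⟩ := IsFractionRing.div_surjective (A := D) y
    have hb0 := nonZeroDivisors.ne_zero hb
    by_cases ha0 : a = 0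
    · exact Or.inl ⟨0, 1, hM.isMaxT.isPrime.one_notMem, by simp [ha0]⟩
    obtain ⟨m, u, h⟩ := hM.exists_isUniformizer
    have hmK : algebraMap D K m ≠ 0 := by simpa using hM.uniformizer_ne_zero h
    have haK : algebraMap D K a ≠ 0 := by simpa using ha0
    have hbK : algebraMap D K b ≠ 0 := by simpa using hb0
    -- A quotient of an element of order n + k by one of order n has a denominator outside M.
    have aux : ∀ a b : D, algebraMap D K a ≠ 0 → algebraMap D K b ≠ 0 →
        ∀ (n k : ℕ) (s t s' t' : D), s ∉ M → t' ∉ M → s * a = t * m ^ (n + k) →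
        s' * b = t' * m ^ n →
        ∃ a', ∃ r ∉ M, algebraMap D K a / algebraMap D K b * algebraMap D K r =
          algebraMap D K a' := by
      intro a b ha hb n k s t s' t' hs ht' h1 h2
      refine ⟨s' * t * m ^ k, s * t', hM.isMaxT.isPrime.mul_notMem hs ht', ?_⟩
      rw [div_mul_eq_mul_div, div_eq_iff hb, ← map_mul, ← map_mul]
      congr 1
      linear_combination t' * h1 - t * m ^ k * h2
    obtain ⟨n, s, hs, t, ht, h1⟩ := hM.exists_factorization h ha0
    obtain ⟨n', s', hs', t', ht', h2⟩ := hM.exists_factorization h hb0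
    rcases le_total n' n with hn | hn
    · obtain ⟨k, rfl⟩ := Nat.exists_eq_add_of_le hn
      exact Or.inl (aux a b haK hbK n' k s t s' t' hs ht' h1 h2)
    · obtain ⟨k, rfl⟩ := Nat.exists_eq_add_of_le hn
      refine Or.inr ?_
      rw [inv_div]
      exact aux b a hbK haK n k s' t' s t hs' ht h2 h1

variable {M : Ideal D} (hM : IsRegular M)

theorem algebraMap_mem_localizationSubring (d : D) :
    algebraMap D K d ∈ localizationSubring K hM :=
  ⟨d, 1, hM.isMaxT.isPrime.one_notMem, by simp⟩

theorem inv_algebraMap_mem_localizationSubring {d : D} (hd : d ≠ 0) :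
    (algebraMap D K d)⁻¹ ∈ localizationSubring K hM ↔ d ∉ M := by
  have hdK : algebraMap D K d ≠ 0 := by simpa using hd
  constructor
  · rintro ⟨a, s, hs, h⟩ hdM
    rw [inv_mul_eq_iff_eq_mul₀ hdK, ← map_mul] at h
    exact hs (IsFractionRing.injective D K h ▸ M.mul_mem_right a hdM)
  · exact fun h => ⟨1, d, h, by simp [hdK]⟩

theorem mem_nonunits_localizationSubring {d : D} (hd : d ≠ 0) :
    algebraMap D K d ∈ (localizationSubring K hM).nonunits ↔ d ∈ M := by
  have hdK : algebraMap D K d ≠ 0 := by simpa using hd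
  rw [ValuationSubring.mem_nonunits_iff_or, or_iff_right hdK,
    inv_algebraMap_mem_localizationSubring K hM hd, not_not]

/-- The prime element is m. If m = (a/s)(b/t) with a, b ∈ M, then u a = m k gives k b = s t u, an
element of M that is a product of elements outside M. -/
theorem isDiscreteValuationRing_localizationSubring :
    IsDiscreteValuationRing (localizationSubring K hM) := by
  have hP := hM.isMaxT.isPrime
  obtain ⟨m, u, h⟩ := hM.exists_isUniformizer
  have hm0 := hM.uniformizer_ne_zero h
  have hmK : algebraMap D K m ≠ 0 := by simpa using hm0
  have hK : ∀ {s : D}, s ∉ M → algebraMap D K s ≠ 0 := fun {s} hs h0 => hs (by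
    rw [(by simpa using h0 : s = 0)]
    exact M.zero_mem)
  let p : localizationSubring K hM := ⟨algebraMap D K m, algebraMap_mem_localizationSubring K hM m⟩
  have hp0 : p ≠ 0 := fun h0 => hmK (congrArg Subtype.val h0)
  refine IsDiscreteValuationRing.ofHasUnitMulPowIrreducibleFactorization ⟨p, ⟨?_, ?_⟩, ?_⟩
  · rw [isUnit_iff_inv_mem _ hp0, inv_algebraMap_mem_localizationSubring K hM hm0, not_not]
    exact h.mem
  · rintro x y hxy
    have hx0 : x ≠ 0 := by rintro rfl; exact hp0 (by rw [hxy, zero_mul])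
    have hy0 : y ≠ 0 := by rintro rfl; exact hp0 (by rw [hxy, mul_zero])
    have hunit : ∀ z : localizationSubring K hM, z ≠ 0 → ∀ a s : D,
        (z : K) * algebraMap D K s = algebraMap D K a → a ∉ M → IsUnit z := by
      intro z hz0 a s hz ha
      have hzK : (z : K) ≠ 0 := by simpa using hz0
      rw [isUnit_iff_inv_mem _ hz0]
      exact ⟨s, a, ha, by rw [← hz, inv_mul_cancel_left₀ hzK]⟩
    obtain ⟨a, s, hs, hx⟩ := x.2
    obtain ⟨b, t, ht, hy⟩ := y.2
    by_contra! hcon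
    have ha : a ∈ M := by_contra fun ha => hcon.1 (hunit x hx0 a s hx ha)
    have hb : b ∈ M := by_contra fun hb => hcon.2 (hunit y hy0 b t hy hb)
    obtain ⟨k, hk⟩ := h.dvd a ha
    have hxyK : algebraMap D K m = (x : K) * y := congrArg Subtype.val hxy
    have hab : a * b = m * (s * t) := by
      apply IsFractionRing.injective D K
      simp only [map_mul, ← hx, ← hy, hxyK]
      ring
    have : k * b = s * t * u := by
      refine mul_left_cancel₀ hm0 ?_
      linear_combination u * hab - b * hk
    exact hP.mul_notMem (hP.mul_notMem hs ht) h.notMem (this ▸ M.mul_mem_left k hb)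
  · intro x hx0
    have hxK : (x : K) ≠ 0 := by simpa using hx0
    obtain ⟨a, s, hs, hx⟩ := x.2
    have ha0 : a ≠ 0 := by
      rintro rfl
      rw [map_zero] at hx
      exact mul_ne_zero hxK (hK hs) hx
    obtain ⟨n, s', hs', t, ht, hst⟩ := hM.exists_factorization h ha0
    have hss := hP.mul_notMem hs hs'
    have hmem : algebraMap D K t / algebraMap D K (s * s') ∈ localizationSubring K hM :=
      ⟨t, s * s', hss, div_mul_cancel₀ _ (hK hss)⟩
    have hmem0 : (⟨_, hmem⟩ : localizationSubring K hM) ≠ 0 := fun h0 =>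
      div_ne_zero (hK ht) (hK hss) (congrArg Subtype.val h0)
    have hunit : IsUnit (⟨_, hmem⟩ : localizationSubring K hM) := by
      rw [isUnit_iff_inv_mem _ hmem0]
      refine ⟨s * s', t, ht, ?_⟩
      rw [inv_div, div_mul_cancel₀ _ (hK ht)]
    refine ⟨n, hunit.unit, Subtype.ext ?_⟩
    change algebraMap D K m ^ n * (algebraMap D K t / algebraMap D K (s * s')) = x
    rw [← mul_div_assoc, div_eq_iff (hK hss), map_mul, ← mul_assoc, hx, ← map_pow, ← map_mul,
      ← map_mul]
    congr 1
    linear_combination -hst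

variable (D) in
theorem isKrullDomain_of_isRegular (hreg : ∀ M : Ideal D, IsMaxT M → IsRegular M) :
    IsKrullDomain D K := by
  refine ⟨Set.range fun M : {M : Ideal D // IsMaxT M} => localizationSubring K (hreg M.1 M.2),
    ?_, fun y => ⟨?_, fun h => ?_⟩, fun d hd => ?_⟩
  · rintro _ ⟨M, rfl⟩
    exact isDiscreteValuationRing_localizationSubring K _
  · rintro ⟨d, rfl⟩ _ ⟨M, rfl⟩
    exact algebraMap_mem_localizationSubring K _ d
  · obtain ⟨a, b, hb, rfl⟩ := IsFractionRing.div_surjective (A := D) y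
    have hb0 := nonZeroDivisors.ne_zero hb
    have hbK : algebraMap D K b ≠ 0 := by simpa using hb0
    obtain ⟨k, rfl⟩ := dvd_of_forall_isMaxT (a := a) hb0 fun M hM => by
      obtain ⟨k, s, hs, hk⟩ := h _ ⟨⟨M, hM⟩, rfl⟩
      rw [div_mul_eq_mul_div, div_eq_iff hbK, ← map_mul, ← map_mul] at hk
      refine ⟨s, hs, k, ?_⟩
      linear_combination IsFractionRing.injective D K hk
    exact ⟨k, by rw [map_mul, mul_div_cancel_left₀ _ hbK]⟩
  · have hfin := finite_isMaxT_mem hreg hd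
    have hfin' : {N : {M : Ideal D // IsMaxT M} | d ∈ N.1}.Finite :=
      Set.Finite.of_finite_image (hfin.subset (by
        rintro _ ⟨N, hN, rfl⟩
        exact ⟨N.2, hN⟩)) Subtype.val_injective.injOn
    refine (hfin'.image fun M : {M : Ideal D // IsMaxT M} =>
      localizationSubring K (hreg M.1 M.2)).subset ?_
    rintro _ ⟨⟨M, rfl⟩, hV⟩
    exact ⟨M, (mem_nonunits_localizationSubring K _ hd).1 hV, rfl⟩

variable {K}

/-- Krull domains are completely integrally closed. -/
theorem dvd_of_forall_pow_dvd (h : IsKrullDomain D K) {b c x : D} (hc : c ≠ 0) (hx : x ≠ 0)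
    (hdvd : ∀ n : ℕ, c ^ n ∣ b ^ n * x) : c ∣ b := by
  obtain ⟨F, hdvr, hF, -⟩ := h
  rw [dvd_iff_forall_mem hF hc]
  intro V hV
  have := hdvr V hV
  refine mem_of_forall_pow_mul_mem V (x := algebraMap D K x) (by simpa using hx) fun n => ?_
  have := (dvd_iff_forall_mem hF (pow_ne_zero n hc)).1 (hdvd n) V hV
  rwa [map_mul, map_pow, map_pow, mul_div_right_comm, ← div_pow] at this

/-- Generate J by a nonzero x ∈ I and an element of I of least value at each of the finitely many V
where x is a nonunit. At every other V, x itself is a unit and suffices. -/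
theorem exists_fg_le_divClosure (h : IsKrullDomain D K) (I : Ideal D) :
    ∃ J : Ideal D, J.FG ∧ J ≤ I ∧ I ≤ divClosure J := by
  classical
  obtain ⟨F, hdvr, hF, hfin⟩ := h
  by_cases hI : I = ⊥
  · exact ⟨⊥, Submodule.fg_bot, bot_le, hI ▸ le_divClosure _⟩
  obtain ⟨x, hxI, hx⟩ := Submodule.exists_mem_ne_zero_of_ne_bot hI
  have hFD : ∀ V ∈ F, ∀ d : D, algebraMap D K d ∈ V := fun V hV d => (hF _).1 ⟨d, rfl⟩ V hV
  have hy : ∀ V ∈ F, ∃ y ∈ I, y ≠ 0 ∧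
      ∀ i ∈ I, ∃ v ∈ V, algebraMap D K i = algebraMap D K y * v := fun V hV => by
    have := hdvr V hV
    exact exists_forall_mem_eq_mul V (hFD V hV) hI
  choose! y hyI hy0 hy using hy
  let S : Finset D := insert x ((hfin x hx).toFinset.image y)
  have hSI : ∀ s ∈ S, s ∈ I := by
    intro s hs
    rcases Finset.mem_insert.1 hs with rfl | hs
    · exact hxI
    · obtain ⟨V, hV, rfl⟩ := Finset.mem_image.1 hs
      exact hyI V ((hfin x hx).mem_toFinset.1 hV).1
  refine ⟨Ideal.span S, ⟨S, rfl⟩, Ideal.span_le.2 hSI, fun i hi b c hbc => ?_⟩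
  have hbS : ∀ s ∈ S, c ∣ b * s := fun s hs => hbc s (Ideal.subset_span hs)
  by_cases hc : c = 0
  · have := hbS x (Finset.mem_insert_self _ _)
    rw [hc, zero_dvd_iff, mul_eq_zero, or_iff_left hx] at this
    simp [this]
  rw [dvd_iff_forall_mem hF hc]
  intro V hV
  by_cases hxV : algebraMap D K x ∈ V.nonunits
  · obtain ⟨v, hv, hiv⟩ := hy V hV i hi
    have := (dvd_iff_forall_mem hF hc).1 (hbS (y V) (Finset.mem_insert_of_mem
      (Finset.mem_image_of_mem y ((hfin x hx).mem_toFinset.2 ⟨hV, hxV⟩)))) V hV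
    have := V.mul_mem _ _ this hv
    rwa [map_mul, div_mul_eq_mul_div, mul_assoc, ← hiv, ← map_mul] at this
  · have hxK : algebraMap D K x ≠ 0 := by simpa using hx
    rw [ValuationSubring.mem_nonunits_iff_or, or_iff_right hxK, not_not] at hxV
    have := (dvd_iff_forall_mem hF hc).1 (hbS x (Finset.mem_insert_self _ _)) V hV
    have := V.mul_mem _ _ (V.mul_mem _ _ this hxV) (hFD V hV i)
    convert this using 1
    simp only [map_mul]
    field_simp

/-- M_v ≠ D because M ⊆ J_v for a finitely generated J ⊆ M, so some b/c ∈ M⁻¹ lies outside D.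
Complete integral closedness forbids a nonzero y with (b/c)^n y ∈ D for all n; any y in all (M^n)_v
has that property. -/
theorem isRegular_of_isKrullDomain (h : IsKrullDomain D K) (hM : IsMaxT M) : IsRegular M := by
  obtain ⟨x, hxM, hx⟩ := Submodule.exists_mem_ne_zero_of_ne_bot hM.ne_bot
  obtain ⟨J, hJ, hJM, hMJ⟩ := exists_fg_le_divClosure h M
  have h1 : 1 ∉ divClosure M := fun h1 =>
    hM.one_notMem_divClosure hJ hJM (divClosure_le_of_le hMJ h1)
  rw [mem_divClosure] at h1
  push Not at h1
  obtain ⟨b, c, hbc, hcb⟩ := h1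
  rw [mul_one] at hcb
  have hc : c ≠ 0 := by
    rintro rfl
    have := (mul_eq_zero.1 (zero_dvd_iff.1 (hbc x hxM))).resolve_right hx
    exact hcb (this ▸ dvd_rfl)
  refine ⟨hM, ?_, fun y hy => ?_⟩
  · by_contra hcon
    -- If no m generates M locally at M, then M M⁻¹ ⊆ M, so multiplication by b/c preserves M.
    have hstep : ∀ m ∈ M, ∃ k ∈ M, b * m = c * k := by
      intro m hm
      obtain ⟨u, hu⟩ := hbc m hm
      by_contra! hno
      refine hcon ⟨m, hm, u, fun huM => hno u huM hu, fun j hj => ?_⟩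
      obtain ⟨k, hk⟩ := hbc j hj
      refine ⟨k, mul_left_cancel₀ hc ?_⟩
      linear_combination m * hk - j * hu
    refine hcb (dvd_of_forall_pow_dvd h hc hx fun n => ?_)
    suffices ∃ k ∈ M, b ^ n * x = c ^ n * k from this.elim fun k hk => ⟨k, hk.2⟩
    induction n with
    | zero => exact ⟨x, hxM, by simp⟩
    | succ n ih =>
      obtain ⟨k, hk, hbk⟩ := ih
      obtain ⟨l, hl, hbl⟩ := hstep k hk
      refine ⟨l, hl, ?_⟩
      linear_combination b * hbk + c ^ n * hbl
  · by_contra hy0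
    refine hcb (dvd_of_forall_pow_dvd h hc hy0 fun n => ?_)
    rcases Nat.eq_zero_or_pos n with rfl | hn
    · simp
    · exact hy n hn _ _ (pow_dvd_of_forall_dvd hbc n)

variable (D K) in
theorem isKrullDomain_iff : IsKrullDomain D K ↔ ∀ M : Ideal D, IsMaxT M → IsRegular M :=
  ⟨fun h _ hM => isRegular_of_isKrullDomain h hM, isKrullDomain_of_isRegular D K⟩

end Krull

/-! ### The five characterizations -/

section Characterizations

variable {D : Type*} [CommRing D]

theorem le_pow_of_le_mul {P M : Ideal D} (h : P ≤ P * M) (n : ℕ) : P ≤ M ^ n := by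
  induction n with
  | zero => simp
  | succ n ih => rw [pow_succ]; exact h.trans (Ideal.mul_mono_left ih)

theorem eq_bot_of_le_mul {P M : Ideal D} (h : P ≤ P * M)
    (hM : (⨅ n : ℕ, ⨅ _ : 1 ≤ n, M ^ n) = ⊥) : P = ⊥ := by
  rw [eq_bot_iff, ← hM]
  exact le_iInf₂ fun n _ => le_pow_of_le_mul h n

theorem isRegular_of_isPrincipal {M : Ideal D} (hM : IsMaxT M) (hp : M.IsPrincipal)
    (hinf : (⨅ n : ℕ, ⨅ _ : 1 ≤ n, M ^ n) = ⊥) : IsRegular M := by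
  obtain ⟨m, rfl⟩ := hp
  refine ⟨hM, ⟨m, Ideal.mem_span_singleton_self m, 1, hM.isPrime.one_notMem, fun j hj => ?_⟩, ?_⟩
  · simpa using Ideal.mem_span_singleton.1 hj
  · intro x hx
    refine (iInf_pow_eq_bot_iff _).1 hinf x fun n hn => ?_
    have := hx n hn
    rwa [Ideal.submodule_span_eq, Ideal.span_singleton_pow, divClosure_span_singleton,
      ← Ideal.span_singleton_pow] at this

/-- Powers of an invertible ideal are divisorial: if m generates M at N with witness u, then x ∈
(M^n)_v gives m^n ∣ u^n x, so (M^n : x) is not inside N. -/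
theorem divClosure_pow_eq {M : Ideal D}
    (h : ∀ N : Ideal D, N.IsMaximal → LocallyPrincipalAt M N) (n : ℕ) :
    divClosure (M ^ n) = M ^ n := by
  refine le_antisymm (fun x hx => ?_) (le_divClosure _)
  let B : Ideal D := (M ^ n).colon {x}
  have hB : ∀ s, s ∈ B ↔ s * x ∈ M ^ n := fun s => by simp [B, Submodule.mem_colon_singleton]
  suffices B = ⊤ by simpa using (hB 1).1 ((Ideal.eq_top_iff_one B).1 this)
  by_contra hBtop
  obtain ⟨N, hN, hBN⟩ := Ideal.exists_le_maximal B hBtop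
  obtain ⟨m, hm, u, hu, hd⟩ := h N hN
  have hun : u ^ n ∈ B := (hB _).2 ((M ^ n).mem_of_dvd
    (hx (u ^ n) (m ^ n) (pow_dvd_of_forall_dvd hd n)) (Ideal.pow_mem_pow hm n))
  exact hu (hN.isPrime.mem_of_pow_mem n (hBN hun))

theorem isRegular_of_locallyPrincipal {M : Ideal D} (hM : IsMaxT M)
    (h : ∀ N : Ideal D, N.IsMaximal → LocallyPrincipalAt M N)
    (hinf : (⨅ n : ℕ, ⨅ _ : 1 ≤ n, M ^ n) = ⊥) : IsRegular M := by
  refine ⟨hM, ?_, fun x hx => (iInf_pow_eq_bot_iff M).1 hinf x fun n hn => ?_⟩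
  · obtain ⟨N, hN, hMN⟩ := Ideal.exists_le_maximal M hM.ne_top
    obtain ⟨m, hm, u, hu, hd⟩ := h N hN
    exact ⟨m, hm, u, fun huM => hu (hMN huM), hd⟩
  · exact divClosure_pow_eq h n ▸ hx n hn

/-- The product of the multipliers of finitely many generators works on all of J, and divisibility
by m then passes to J_v ⊇ M. -/
theorem locallyPrincipalAt_of_fg {M N J : Ideal D} [N.IsPrime] (hJ : J.FG) (hMJ : M ≤ divClosure J)
    {m : D} (hm : m ∈ M) (h : ∀ j ∈ J, ∃ v ∉ N, m ∣ v * j) : LocallyPrincipalAt M N := by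
  obtain ⟨S, rfl⟩ := hJ
  have hS : ∀ j ∈ S, ∃ v ∉ N, m ∣ v * j := fun j hj => h j (Ideal.subset_span hj)
  choose! v hvN hv using hS
  refine ⟨m, hm, ∏ j ∈ S, v j, fun hmem => ?_, fun j hj => hMJ hj _ _ fun i hi => ?_⟩
  · obtain ⟨j, hj, hvj⟩ := Ideal.IsPrime.prod_mem_iff.1 hmem
    exact hvN j hj hvj
  · have hle : Ideal.span (S : Set D) ≤ (Ideal.span {m}).colon {∏ j ∈ S, v j} := by
      refine Ideal.span_le.2 fun s hs => ?_
      rw [SetLike.mem_coe, Submodule.mem_colon_singleton, Ideal.mem_span_singleton, smul_eq_mul,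
        mul_comm]
      exact (hv s hs).trans (mul_dvd_mul_right (Finset.dvd_prod_of_mem v hs) s)
    have := hle hi
    rwa [Submodule.mem_colon_singleton, Ideal.mem_span_singleton, smul_eq_mul, mul_comm] at this

variable [IsDomain D]

theorem iInf_pow_eq_bot_of_isNoetherianRing [IsNoetherianRing D] {M : Ideal D} (hM : M ≠ ⊤) :
    (⨅ n : ℕ, ⨅ _ : 1 ≤ n, M ^ n) = ⊥ := by
  rw [eq_bot_iff, ← Ideal.iInf_pow_eq_bot_of_isDomain M hM]
  refine le_iInf fun n => ?_
  rcases Nat.eq_zero_or_pos n with rfl | hn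
  · simp
  · exact iInf₂_le n hn

theorem isPrincipalIdealRing_iff :
    IsPrincipalIdealRing D ↔
      ∀ M : Ideal D, M.IsMaximal → M.IsPrincipal ∧ (⨅ n : ℕ, ⨅ _ : 1 ≤ n, M ^ n) = ⊥ := by
  refine ⟨fun h M hM => ⟨h.principal M, iInf_pow_eq_bot_of_isNoetherianRing hM.ne_top⟩,
    fun h => IsPrincipalIdealRing.of_prime fun P hP => ?_⟩
  obtain ⟨M, hM, hPM⟩ := P.exists_le_maximal hP.ne_top
  obtain ⟨⟨p, rfl⟩, hinf⟩ := h M hM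
  by_cases hp : p ∈ P
  · have : P = Ideal.span {p} := le_antisymm hPM (by simpa [Ideal.span_le] using hp)
    exact ⟨p, this⟩
  -- Here P = pP, since P is prime and p ∉ P.
  · have hP0 : P = ⊥ := by
      refine eq_bot_of_le_mul (fun x hx => ?_) hinf
      obtain ⟨y, rfl⟩ := Ideal.mem_span_singleton.1 (hPM hx)
      rw [mul_comm p y]
      exact Ideal.mul_mem_mul ((hP.mem_or_mem hx).resolve_left hp)
        (Ideal.mem_span_singleton_self p)
    exact hP0 ▸ ⟨0, by simp⟩

theorem isDedekindDomain_iff (K : Type*) [Field K] [Algebra D K] [IsFractionRing D K]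
    (hD : ¬ IsField D) :
    IsDedekindDomain D ↔
      ∀ M : Ideal D, M.IsMaximal →
        IsInvertibleIdeal K M ∧ (⨅ n : ℕ, ⨅ _ : 1 ≤ n, M ^ n) = ⊥ := by
  constructor
  · intro h M hM
    refine ⟨mul_inv_cancel₀ (FractionalIdeal.coeIdeal_ne_zero.2 ?_),
      iInf_pow_eq_bot_of_isNoetherianRing hM.ne_top⟩
    exact Ring.ne_bot_of_isMaximal_of_not_isField hM hD
  · intro h
    have factor : ∀ {I M : Ideal D}, M.IsMaximal → I ≤ M → ∃ J : Ideal D, I = J * M := by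
      intro I M hM hIM
      have hinv : (M : FractionalIdeal D⁰ K) * (M : FractionalIdeal D⁰ K)⁻¹ = 1 := (h M hM).1
      have hle : (I : FractionalIdeal D⁰ K) * (M : FractionalIdeal D⁰ K)⁻¹ ≤ 1 := by
        rw [← hinv]
        exact mul_le_mul_left ((FractionalIdeal.coeIdeal_le_coeIdeal K).2 hIM) _
      obtain ⟨J, hJ⟩ := FractionalIdeal.le_one_iff_exists_coeIdeal.1 hle
      refine ⟨J, FractionalIdeal.coeIdeal_injective (K := K) ?_⟩
      change (I : FractionalIdeal D⁰ K) = ((J * M : Ideal D) : FractionalIdeal D⁰ K)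
      rw [FractionalIdeal.coeIdeal_mul, hJ, mul_assoc, mul_comm _ (M : FractionalIdeal D⁰ K),
        hinv, mul_one]
    have hnoeth : IsNoetherianRing D := by
      refine IsNoetherianRing.of_prime fun P hP => ?_
      obtain ⟨M, hM, hPM⟩ := P.exists_le_maximal hP.ne_top
      by_cases hMP : M ≤ P
      · obtain rfl := le_antisymm hPM hMP
        exact Ideal.fg_of_isUnit (IsFractionRing.injective D K) P
          (IsUnit.of_mul_eq_one _ (h P hM).1)
      -- From P = JM and M ⊄ P, primality gives J ⊆ P, hence P = PM.
      · obtain ⟨J, hJ⟩ := factor hM hPM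
        have hJP : J ≤ P := (hP.mul_le.1 hJ.ge).resolve_right hMP
        rw [eq_bot_of_le_mul (hJ.le.trans (Ideal.mul_mono_left hJP)) (h M hM).2]
        exact Submodule.fg_bot
    -- Noetherian induction: I = JM with J strictly larger, as J = JM would force J = 0.
    have hunit : ∀ I : Ideal D, I ≠ ⊥ → IsUnit (I : FractionalIdeal D⁰ K) := by
      intro I
      induction I using WellFoundedGT.induction with
      | ind I ih =>
        intro hI
        by_cases htop : I = ⊤
        · simp [htop]
        · obtain ⟨M, hM, hIM⟩ := I.exists_le_maximal htop
          obtain ⟨J, rfl⟩ := factor hM hIM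
          have hJ : J ≠ ⊥ := by
            rintro rfl
            exact hI (Ideal.bot_mul M)
          have hlt : J * M < J := lt_of_le_of_ne Ideal.mul_le_left fun heq =>
            hJ (eq_bot_of_le_mul heq.ge (h M hM).2)
          rw [FractionalIdeal.coeIdeal_mul]
          exact (ih J hlt hJ).mul (IsUnit.of_mul_eq_one _ (h M hM).1)
    rw [isDedekindDomain_iff_mul_inv_cancel (K := K)]
    intro I hI
    have hnum := hunit I.num fun h0 => hI (FractionalIdeal.num_eq_zero_iff.1 h0)
    rw [← FractionalIdeal.den_mul_self_eq_num'] at hnum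
    exact FractionalIdeal.mul_inv_cancel_iff_isUnit K |>.2 (isUnit_of_mul_isUnit_right hnum)

/-- This says (p, y)_v = D, so a maximal t-ideal containing the prime p contains only multiples of
p. -/
theorem dvd_of_prime_of_dvd_mul {p y b c : D} (hp : Prime p) (hpy : ¬ p ∣ y) (h1 : c ∣ b * p)
    (h2 : c ∣ b * y) : c ∣ b := by
  obtain ⟨k, hk⟩ := h1
  obtain ⟨l, hl⟩ := h2
  by_cases hc : c = 0
  · subst hc
    rw [zero_mul, mul_eq_zero, or_iff_left hp.ne_zero] at hk
    exact hk ▸ dvd_rfl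
  have : k * y = p * l := mul_left_cancel₀ hc (by linear_combination p * hl - y * hk)
  obtain ⟨e, rfl⟩ := (hp.dvd_or_dvd ⟨l, this⟩).resolve_right hpy
  exact ⟨e, mul_left_cancel₀ hp.ne_zero (by linear_combination hk)⟩

theorem uniqueFactorizationMonoid_iff :
    UniqueFactorizationMonoid D ↔
      ∀ M : Ideal D, IsMaxT M → M.IsPrincipal ∧ (⨅ n : ℕ, ⨅ _ : 1 ≤ n, M ^ n) = ⊥ := by
  rw [UniqueFactorizationMonoid.iff_exists_prime_mem_of_isPrime]
  constructor
  · intro h M hM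
    have := UniqueFactorizationMonoid.iff_exists_prime_mem_of_isPrime.2 h
    obtain ⟨p, hpM, hp⟩ := h M hM.ne_bot hM.isPrime
    have hMp : M = Ideal.span {p} := by
      refine le_antisymm (fun y hy => ?_) (by simpa [Ideal.span_le] using hpM)
      rw [Ideal.mem_span_singleton]
      by_contra hpy
      refine hM.one_notMem_divClosure (J := Ideal.span {p, y})
        (Submodule.fg_span (Set.toFinite _)) ?_ ?_
      · simp [Ideal.span_le, Set.insert_subset_iff, hpM, hy]
      · intro b c hbc
        rw [mul_one]
        exact dvd_of_prime_of_dvd_mul hp hpy (hbc p (Ideal.subset_span (by simp)))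
          (hbc y (Ideal.subset_span (by simp)))
    refine ⟨⟨p, hMp⟩, (iInf_pow_eq_bot_iff M).2 fun x hx => ?_⟩
    by_contra hx0
    obtain ⟨n, hn⟩ := FiniteMultiplicity.of_not_isUnit hp.not_isUnit hx0
    have := hx (n + 1) (by omega)
    rw [hMp, Ideal.span_singleton_pow, Ideal.mem_span_singleton] at this
    exact hn this
  · intro h P hP0 hP
    obtain ⟨M, hM, hMP⟩ := exists_isMaxT_le_of_isPrime
      (fun M hM => isRegular_of_isPrincipal hM (h M hM).1 (h M hM).2) hP0
    obtain ⟨⟨m, rfl⟩, -⟩ := h M hM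
    refine ⟨m, hMP (Ideal.mem_span_singleton_self m), ?_⟩
    rw [← Ideal.span_singleton_prime]
    · exact hM.isPrime
    · rintro rfl
      exact hM.ne_bot (by simp)

/-- A nonzero prime of D_N contracts to a prime containing some maximal t-ideal M; then M D_N is a
principal prime and its generator is a prime element. -/
theorem isLocallyFactorial_of_locallyPrincipal
    (hreg : ∀ M : Ideal D, IsMaxT M → IsRegular M)
    (h : ∀ M : Ideal D, IsMaxT M → ∀ N : Ideal D, N.IsMaximal → LocallyPrincipalAt M N) :
    IsLocallyFactorial D := by
  intro N hN
  have hdisj : ∀ {d}, algebraMap D (Localization.AtPrime N) d = 0 → d = 0 := fun {d} hd =>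
    (map_eq_zero_iff _ (IsLocalization.injective _ N.primeCompl_le_nonZeroDivisors)).1 hd
  rw [UniqueFactorizationMonoid.iff_exists_prime_mem_of_isPrime]
  intro Q hQ0 hQ
  let P := Q.comap (algebraMap D (Localization.AtPrime N))
  have hPN : P ≤ N := by
    have := (IsLocalization.disjoint_under_iff N.primeCompl (Localization.AtPrime N) Q).2 hQ.ne_top
    intro x hx
    by_contra hxN
    exact Set.disjoint_left.1 this hxN hx
  have hP0 : P ≠ ⊥ := by
    intro hP
    apply hQ0
    rw [← IsLocalization.map_under N.primeCompl (Localization.AtPrime N) Q]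
    change P.map _ = ⊥
    rw [hP, Ideal.map_bot]
  obtain ⟨M, hM, hMP⟩ := exists_isMaxT_le_of_isPrime hreg hP0
  obtain ⟨m, hm, u, hu, hd⟩ := h M hM N hN
  have hspan : Ideal.span {algebraMap D (Localization.AtPrime N) m} =
      M.map (algebraMap D (Localization.AtPrime N)) := by
    refine le_antisymm ?_ (Ideal.map_le_iff_le_comap.2 fun j hj => ?_)
    · simpa [Ideal.span_le] using Ideal.mem_map_of_mem _ hm
    · rw [Ideal.mem_comap, Ideal.mem_span_singleton]
      have hunit := IsLocalization.map_units (Localization.AtPrime N) (⟨u, hu⟩ : N.primeCompl)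
      have := map_dvd (algebraMap D (Localization.AtPrime N)) (hd j hj)
      rw [map_mul] at this
      exact (hunit.dvd_mul_left).1 this
  refine ⟨algebraMap D (Localization.AtPrime N) m, hMP hm, ?_⟩
  rw [← Ideal.span_singleton_prime, hspan]
  · refine IsLocalization.isPrime_of_isPrime_disjoint N.primeCompl _ M hM.isPrime ?_
    exact Set.disjoint_left.2 fun x hx hxM => hx (hPN (hMP hxM))
  · intro h0
    obtain rfl := hdisj h0
    exact hM.ne_bot (((hreg M hM).locallyPrincipal).elim fun _ _ => by
      refine (Submodule.eq_bot_iff _).2 fun j hj => ?_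
      have h0 := zero_dvd_iff.1 (hd j hj)
      exact (mul_eq_zero.1 h0).resolve_left fun h' => hu (h' ▸ N.zero_mem))

/-- In the UFD D_N the prime M D_N contains a prime element, and since M has height one that element
generates M D_N. Finite generation of J lets one denominator serve. -/
theorem locallyPrincipalAt_of_isLocallyFactorial (hfac : IsLocallyFactorial D) {M N J : Ideal D}
    (hM : IsRegular M) (hN : N.IsMaximal) (hJ : J.FG) (hJM : J ≤ M) (hMJ : M ≤ divClosure J) :
    LocallyPrincipalAt M N := by
  by_cases hMN : M ≤ N
  swap
  -- Off N, any m ∈ M outside N is its own witness.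
  · obtain ⟨m, hm, hmN⟩ := SetLike.not_le_iff_exists.1 hMN
    exact ⟨m, hm, m, hmN, fun j _ => dvd_mul_right m j⟩
  have hinj := IsLocalization.injective (Localization.AtPrime N) N.primeCompl_le_nonZeroDivisors
  have hMprime := hM.isMaxT.isPrime
  have hdisj : Disjoint (N.primeCompl : Set D) M := Set.disjoint_left.2 fun x hx hxM => hx (hMN hxM)
  have hQ := IsLocalization.isPrime_of_isPrime_disjoint N.primeCompl (Localization.AtPrime N) M
    hMprime hdisj
  have hcomap := IsLocalization.under_map_of_isPrime_disjoint N.primeCompl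
    (Localization.AtPrime N) hMprime hdisj
  obtain ⟨p, hpQ, hp⟩ := UniqueFactorizationMonoid.iff_exists_prime_mem_of_isPrime.1 (hfac N)
    (M.map (algebraMap D (Localization.AtPrime N)))
    (fun h => hM.isMaxT.ne_bot ((Ideal.map_eq_bot_iff_of_injective hinj).1 h)) hQ
  obtain ⟨⟨m, s⟩, hms⟩ := IsLocalization.surj N.primeCompl p
  dsimp only at hms
  have hassoc : Associated p (algebraMap D (Localization.AtPrime N) m) :=
    ⟨(IsLocalization.map_units (Localization.AtPrime N) s).unit, hms⟩
  have hpm := hassoc.prime hp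
  let P := (Ideal.span {algebraMap D (Localization.AtPrime N) m}).comap
    (algebraMap D (Localization.AtPrime N))
  have hPprime : P.IsPrime := Ideal.IsPrime.comap _
    (hK := (Ideal.span_singleton_prime hpm.ne_zero).2 hpm)
  have hmP : m ∈ P := Ideal.mem_span_singleton_self _
  have hm0 : m ≠ 0 := fun h0 => hpm.ne_zero (by rw [h0, map_zero])
  have hPM : P = M := by
    refine hM.eq_of_isPrime_le (fun h => hm0 (by simpa [h] using hmP)) ?_
    rw [← hcomap]
    refine Ideal.comap_mono ((Ideal.span_singleton_le_iff_mem _).2 ?_)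
    exact hms ▸ Ideal.mul_mem_right _ _ hpQ
  refine locallyPrincipalAt_of_fg hJ hMJ (hPM ▸ hmP) fun j hj => ?_
  have hjP : j ∈ P := hPM ▸ hJM hj
  obtain ⟨q, hq⟩ := Ideal.mem_span_singleton.1 hjP
  obtain ⟨⟨a, t⟩, hat⟩ := IsLocalization.surj N.primeCompl q
  refine ⟨t, t.2, a, hinj ?_⟩
  rw [map_mul, map_mul, hq, ← hat]
  ring

theorem isLocallyFactorial_and_isKrullDomain_iff (K : Type*) [Field K] [Algebra D K]
    [IsFractionRing D K] :
    IsLocallyFactorial D ∧ IsKrullDomain D K ↔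
      ∀ M : Ideal D, IsMaxT M → IsInvertibleIdeal K M ∧ (⨅ n : ℕ, ⨅ _ : 1 ≤ n, M ^ n) = ⊥ := by
  constructor
  · rintro ⟨hfac, hK⟩ M hM
    have hreg := isRegular_of_isKrullDomain hK hM
    obtain ⟨J, hJ, hJM, hMJ⟩ := exists_fg_le_divClosure hK M
    rw [isInvertibleIdeal_iff K hM.ne_bot]
    refine ⟨fun N hN => locallyPrincipalAt_of_isLocallyFactorial hfac hreg hN hJ hJM hMJ, ?_⟩
    rw [iInf_pow_eq_bot_iff]
    exact fun x hx => hreg.separated x fun n hn => le_divClosure _ (hx n hn)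
  · intro h
    have hlp : ∀ M : Ideal D, IsMaxT M → ∀ N : Ideal D, N.IsMaximal → LocallyPrincipalAt M N :=
      fun M hM => (isInvertibleIdeal_iff K hM.ne_bot).1 (h M hM).1
    have hreg : ∀ M : Ideal D, IsMaxT M → IsRegular M :=
      fun M hM => isRegular_of_locallyPrincipal hM (hlp M hM) (h M hM).2
    exact ⟨isLocallyFactorial_of_locallyPrincipal hreg hlp, isKrullDomain_of_isRegular D K hreg⟩

end Characterizations

end TIdeal

theorem theorem3p5 {D K : Type*} [CommRing D] [IsDomain D] [Field K] [Algebra D K]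
    [IsFractionRing D K] (hD : ¬ IsField D) :
    (IsPrincipalIdealRing D ↔
      ∀ M : Ideal D, M.IsMaximal → M.IsPrincipal ∧ (⨅ n : ℕ, ⨅ _ : 1 ≤ n, M ^ n) = ⊥) ∧
    (IsDedekindDomain D ↔
      ∀ M : Ideal D, M.IsMaximal →
        IsInvertibleIdeal K M ∧ (⨅ n : ℕ, ⨅ _ : 1 ≤ n, M ^ n) = ⊥) ∧
    (UniqueFactorizationMonoid D ↔
      ∀ M : Ideal D, IsMaximalTIdeal K M →
        M.IsPrincipal ∧ (⨅ n : ℕ, ⨅ _ : 1 ≤ n, M ^ n) = ⊥) ∧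
    (IsLocallyFactorial D ∧ IsKrullDomain D K ↔
      ∀ M : Ideal D, IsMaximalTIdeal K M →
        IsInvertibleIdeal K M ∧ (⨅ n : ℕ, ⨅ _ : 1 ≤ n, M ^ n) = ⊥) ∧
    (IsKrullDomain D K ↔
      ∀ M : Ideal D, IsMaximalTIdeal K M →
        IsTInvertibleIdeal K M ∧
          (⨅ n : ℕ, ⨅ _ : 1 ≤ n,
            (vClosure ((M ^ n : Ideal D) : FractionalIdeal D⁰ K) : Submodule D K)) = ⊥) := by
  simp only [TIdeal.isMaximalTIdeal_iff]
  refine ⟨TIdeal.isPrincipalIdealRing_iff, TIdeal.isDedekindDomain_iff K hD,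
    TIdeal.uniqueFactorizationMonoid_iff, TIdeal.isLocallyFactorial_and_isKrullDomain_iff K, ?_⟩
  rw [TIdeal.isKrullDomain_iff]
  exact forall₂_congr fun M hM => TIdeal.isRegular_iff K hM
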